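/- Let $\mathcal{H}$ be a real or complex Hilbert space and let $A$ be a self-adjoint operator on $\mathcal{H}$, densely defined and possibly unbounded, with $\langle\psi,A\psi\rangle\geqslant 0$ for all $\psi\in\mathcal{D}(A)$. Let $C^\infty(A)=\bigcap_{n}\mathcal{D}(A^n)$, let $g\in\mathrm{ran}\,A\cap C^\infty(A)$, $f^{[0]}\in C^\infty(A)$ and $\theta\geqslant 0$. Denote by $\mathcal{S}=\{f\in\mathcal{D}(A)\,|\,Af=g\}$ the (non-empty, closed, convex) solution manifold, and by $P_{\mathcal{S}}x$ the point of $\mathcal{S}$ closest to $x\in\mathcal{H}$. For $N\geqslant 1$ the $N$-th $\theta$-iterate $f^{[N]}$ is the minimiser of $$\|A^{\theta/2}(h-P_{\mathcal{S}}h)\|\quad\text{over}\quad h\in f^{[0]}+\mathrm{span}\{\mathfrak{R}_0,A\mathfrak{R}_0,\dots,A^{N-1}\mathfrak{R}_0\},\qquad \mathfrak{R}_0=Af^{[0]}-g .$$ These iterates are well defined: for each $N\geqslant 1$ all the vectors $h-P_{\mathcal{S}}h$ in the minimisation belong to $\mathcal{D}(A^{\theta/2})$, and the minimiser exists and is unique.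 Moreover: 1. $f^{[N]}-P_{\mathcal{S}}f^{[N]}\in(\ker A)^\perp$ for all $N\geqslant 0$; 2. $P_{\mathcal{S}}f^{[N]}=P_{\mathcal{S}}f^{[0]}$ for all $N\geqslant 1$; 3. for every $N\geqslant 1$ there is a polynomial $p_N$ with real coefficients, of degree at most $N$ and with $p_N(0)=1$, such that $f^{[0]}-P_{\mathcal{S}}f^{[0]}\in\mathcal{D}(p_N(A))$ and $$f^{[N]}-P_{\mathcal{S}}f^{[N]}=p_N(A)\,(f^{[0]}-P_{\mathcal{S}}f^{[0]}).$$ -/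

import Mathlib

open Filter Topology MeasureTheory

noncomputable section

namespace UnboundedOp

variable {𝕜 : Type*} [RCLike 𝕜] {H : Type*} [NormedAddCommGroup H] [InnerProductSpace 𝕜 H]

open Classical in
/-- The vector `B x` if `x` lies in the domain of `B`, and `0` otherwise. -/
def val (B : H →ₗ.[𝕜] H) (x : H) : H :=
  if h : x ∈ B.domain then B ⟨x, h⟩ else 0

theorem val_of_mem (B : H →ₗ.[𝕜] H) {x : H} (h : x ∈ B.domain) : val B x = B ⟨x, h⟩ :=
  dif_pos h

theorem val_add (B : H →ₗ.[𝕜] H) {x y : H} (hx : x ∈ B.domain) (hy : y ∈ B.domain) :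
    val B (x + y) = val B x + val B y := by
  rw [val_of_mem B hx, val_of_mem B hy, val_of_mem B (B.domain.add_mem hx hy), ← B.map_add]
  rfl

theorem val_smul (B : H →ₗ.[𝕜] H) (c : 𝕜) {x : H} (hx : x ∈ B.domain) :
    val B (c • x) = c • val B x := by
  rw [val_of_mem B hx, val_of_mem B (B.domain.smul_mem c hx), ← B.map_smul]
  rfl

theorem val_zero (B : H →ₗ.[𝕜] H) : val B 0 = 0 := by
  rw [val_of_mem B B.domain.zero_mem]
  exact B.map_zero

/-- The set of `x ∈ D(A)` with `A x ∈ D(B)`. -/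
def compDomain (B A : H →ₗ.[𝕜] H) : Submodule 𝕜 H :=
  (B.domain.comap A.toFun).map A.domain.subtype

/-- The product `B A` of two operators, with domain `{x ∈ D(A) | A x ∈ D(B)}`. -/
def comp (B A : H →ₗ.[𝕜] H) : H →ₗ.[𝕜] H :=
  B.comp (A.domRestrict (compDomain B A)) (by
    rintro ⟨x, hx, hxA⟩
    obtain ⟨y, hy, rfl⟩ := hx
    exact hy)

/-- The powers `A ^ n` on their natural domains. -/
def npow (A : H →ₗ.[𝕜] H) : ℕ → (H →ₗ.[𝕜] H)
  | 0 => (LinearMap.id : H →ₗ[𝕜] H).toPMap ⊤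
  | n + 1 => comp A (npow A n)

/-- The space `C^∞(A) = ⋂ₙ D(A ^ n)` of `A`-smooth vectors. -/
def smoothVectors (A : H →ₗ.[𝕜] H) : Submodule 𝕜 H := ⨅ n : ℕ, (npow A n).domain

/-- `ker A`, as a subspace of `H`. -/
def ker (A : H →ₗ.[𝕜] H) : Submodule 𝕜 H := (LinearMap.ker A.toFun).map A.domain.subtype

/-- `ran A`. -/
def ran (A : H →ₗ.[𝕜] H) : Submodule 𝕜 H := LinearMap.range A.toFun

/-- `A` is non-negative: `⟨ψ, A ψ⟩ ≥ 0` for `ψ ∈ D(A)`.  (For self-adjoint `A` the number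
`⟨ψ, A ψ⟩` is automatically real.) -/
def IsNonneg (A : H →ₗ.[𝕜] H) : Prop :=
  ∀ x : A.domain, 0 ≤ RCLike.re (inner 𝕜 (x : H) (A x))

/-- `p(A) = ∑ₖ pₖ A ^ k`, on the intersection of the domains of the powers that occur. -/
def polyOp (p : Polynomial ℝ) (A : H →ₗ.[𝕜] H) : H →ₗ.[𝕜] H :=
  p.sum fun k a => (a : 𝕜) • npow A k

/-- The operator `A (t + A)⁻¹`. -/
def resolventPart (A : H →ₗ.[𝕜] H) (t : ℝ) : H →ₗ.[𝕜] H :=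
  comp A (((t : 𝕜) • (LinearMap.id : H →ₗ[𝕜] H)) +ᵥ A).inverse

/-- The integrand `t ^ (α - 1) A (t + A)⁻¹ x` of the Balakrishnan formula. -/
def balakrishnanIntegrand (A : H →ₗ.[𝕜] H) (α : ℝ) (x : H) (t : ℝ) : H :=
  ((t ^ (α - 1) : ℝ) : 𝕜) • val (resolventPart A t) x

/-- `∫₀ᴿ t ^ (α - 1) A (t + A)⁻¹ x dt`, a Bochner integral. -/
def balakrishnanIntegral (A : H →ₗ.[𝕜] H) (α : ℝ) (x : H) (R : ℝ) : H :=
  letI : NormedSpace ℝ H := NormedSpace.restrictScalars ℝ 𝕜 H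
  ∫ t in Set.Ioc (0 : ℝ) R, balakrishnanIntegrand A α x t

/-- `x` is in the domain of `A ^ α` for `0 < α < 1`: the Balakrishnan integral over `(0, ∞)`
converges in norm, as an improper integral at `∞`.  (For `A` self-adjoint and non-negative the
first two clauses hold for every `x`, and by the spectral theorem the third one says that
`∫ λ ^ (2 α) d⟨x, E(λ) x⟩ < ∞`.) -/
def MemFracDomain (A : H →ₗ.[𝕜] H) (α : ℝ) (x : H) : Prop :=
  (∀ t : ℝ, 0 < t → x ∈ (resolventPart A t).domain) ∧
  (∀ R : ℝ, IntegrableOn (balakrishnanIntegrand A α x) (Set.Ioc 0 R)) ∧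
  ∃ y, Tendsto (balakrishnanIntegral A α x) atTop (𝓝 y)

theorem balakrishnanIntegrand_add (A : H →ₗ.[𝕜] H) (α : ℝ) {x y : H}
    (hx : ∀ t : ℝ, 0 < t → x ∈ (resolventPart A t).domain)
    (hy : ∀ t : ℝ, 0 < t → y ∈ (resolventPart A t).domain) (R : ℝ) :
    Set.EqOn (balakrishnanIntegrand A α (x + y))
      (balakrishnanIntegrand A α x + balakrishnanIntegrand A α y) (Set.Ioc 0 R) := by
  intro t ht
  simp only [balakrishnanIntegrand, Pi.add_apply]
  rw [val_add _ (hx t ht.1) (hy t ht.1), smul_add]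

theorem balakrishnanIntegrand_smul (A : H →ₗ.[𝕜] H) (α : ℝ) (c : 𝕜) {x : H}
    (hx : ∀ t : ℝ, 0 < t → x ∈ (resolventPart A t).domain) (R : ℝ) :
    Set.EqOn (balakrishnanIntegrand A α (c • x))
      (c • balakrishnanIntegrand A α x) (Set.Ioc 0 R) := by
  intro t ht
  simp only [balakrishnanIntegrand, Pi.smul_apply]
  rw [val_smul _ c (hx t ht.1), smul_comm]

theorem balakrishnanIntegral_add (A : H →ₗ.[𝕜] H) (α : ℝ) {x y : H}
    (hx : MemFracDomain A α x) (hy : MemFracDomain A α y) :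
    balakrishnanIntegral A α (x + y) =
      balakrishnanIntegral A α x + balakrishnanIntegral A α y := by
  let _ : NormedSpace ℝ H := NormedSpace.restrictScalars ℝ 𝕜 H
  funext R
  simp only [balakrishnanIntegral, Pi.add_apply]
  rw [setIntegral_congr_fun measurableSet_Ioc (balakrishnanIntegrand_add A α hx.1 hy.1 R)]
  exact integral_add (hx.2.1 R) (hy.2.1 R)

theorem balakrishnanIntegral_smul (A : H →ₗ.[𝕜] H) (α : ℝ) (c : 𝕜) {x : H}
    (hx : MemFracDomain A α x) :
    balakrishnanIntegral A α (c • x) = c • balakrishnanIntegral A α x := by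
  let _ : NormedSpace ℝ H := NormedSpace.restrictScalars ℝ 𝕜 H
  have : IsScalarTower ℝ 𝕜 H := RestrictScalars.isScalarTower ℝ 𝕜 H
  funext R
  simp only [balakrishnanIntegral, Pi.smul_apply]
  rw [setIntegral_congr_fun measurableSet_Ioc (balakrishnanIntegrand_smul A α c hx.1 R)]
  exact integral_smul c _

theorem balakrishnanIntegral_zero (A : H →ₗ.[𝕜] H) (α : ℝ) :
    balakrishnanIntegral A α (0 : H) = 0 := by
  funext R
  simp [balakrishnanIntegral, balakrishnanIntegrand, val_zero]

/-- The fractional power `A ^ α`, `0 < α < 1`, given by the Balakrishnan formula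
`A ^ α x = (sin (π α) / π) ∫₀^∞ t ^ (α - 1) A (t + A)⁻¹ x dt`. -/
def fracPow (A : H →ₗ.[𝕜] H) (α : ℝ) : H →ₗ.[𝕜] H where
  domain :=
    { carrier := {x | MemFracDomain A α x}
      zero_mem' := by
        refine ⟨fun t _ => Submodule.zero_mem _, fun R => ?_, 0, ?_⟩
        · have : balakrishnanIntegrand A α (0 : H) = fun _ => 0 := by
            funext t
            simp [balakrishnanIntegrand, val_zero]
          rw [this]
          exact integrableOn_zero
        · rw [balakrishnanIntegral_zero]
          exact tendsto_const_nhds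
      add_mem' := by
        intro x y hx hy
        refine ⟨fun t ht => Submodule.add_mem _ (hx.1 t ht) (hy.1 t ht), fun R => ?_, ?_⟩
        · exact ((hx.2.1 R).add (hy.2.1 R)).congr_fun
            (balakrishnanIntegrand_add A α hx.1 hy.1 R).symm measurableSet_Ioc
        · obtain ⟨u, hu⟩ := hx.2.2
          obtain ⟨v, hv⟩ := hy.2.2
          refine ⟨u + v, ?_⟩
          rw [balakrishnanIntegral_add A α hx hy]
          exact hu.add hv
      smul_mem' := by
        intro c x hx
        refine ⟨fun t ht => Submodule.smul_mem _ c (hx.1 t ht), fun R => ?_, ?_⟩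
        · have hI : IntegrableOn (c • balakrishnanIntegrand A α x) (Set.Ioc 0 R) :=
            (hx.2.1 R).smul c
          exact hI.congr_fun (balakrishnanIntegrand_smul A α c hx.1 R).symm measurableSet_Ioc
        · obtain ⟨u, hu⟩ := hx.2.2
          refine ⟨c • u, ?_⟩
          rw [balakrishnanIntegral_smul A α c hx]
          exact hu.const_smul c }
  toFun :=
    { toFun := fun x => ((Real.sin (Real.pi * α) / Real.pi : ℝ) : 𝕜) •
        limUnder atTop (balakrishnanIntegral A α (x : H))
      map_add' := by
        rintro ⟨x, hx⟩ ⟨y, hy⟩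
        obtain ⟨u, hu⟩ := hx.2.2
        obtain ⟨v, hv⟩ := hy.2.2
        change _ • limUnder atTop (balakrishnanIntegral A α (x + y)) = _
        rw [balakrishnanIntegral_add A α hx hy, ← smul_add, hu.limUnder_eq, hv.limUnder_eq]
        exact congrArg _ (hu.add hv).limUnder_eq
      map_smul' := by
        rintro c ⟨x, hx⟩
        obtain ⟨u, hu⟩ := hx.2.2
        change _ • limUnder atTop (balakrishnanIntegral A α (c • x)) = _
        rw [balakrishnanIntegral_smul A α c hx, RingHom.id_apply, hu.limUnder_eq, smul_comm c]
        exact congrArg _ (hu.const_smul c).limUnder_eq }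

/-- The power `A ^ s`, `s ≥ 0`, of a non-negative self-adjoint operator `A`: the power `A ^ n` if
`s = n` is an integer (in particular `A ^ 0` is the identity), and `A ^ α A ^ n` if `s = n + α`
with `n` an integer and `0 < α < 1`. -/
def rpow (A : H →ₗ.[𝕜] H) (s : ℝ) : H →ₗ.[𝕜] H :=
  if Int.fract s = 0 then npow A ⌊s⌋₊ else comp (fracPow A (Int.fract s)) (npow A ⌊s⌋₊)

/-- The solution manifold `S = {f ∈ D(A) | A f = g}`. -/
def solutionSet (A : H →ₗ.[𝕜] H) (g : H) : Set H := {f | ∃ h : f ∈ A.domain, A ⟨f, h⟩ = g}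

/-- The projection onto a non-empty closed convex set `S`: the point of `S` closest to `x`. -/
def proj (S : Set H) (x : H) : H :=
  Classical.epsilon fun y => y ∈ S ∧ ∀ z ∈ S, ‖x - y‖ ≤ ‖x - z‖

/-- The vector `x - P_S x`, for `S` the solution manifold of `A f = g`. -/
def err (A : H →ₗ.[𝕜] H) (g x : H) : H := x - proj (solutionSet A g) x

/-- The Krylov space `K_N(A, r) = span {r, A r, …, A ^ (N - 1) r}`. -/
def krylov (A : H →ₗ.[𝕜] H) (r : H) (N : ℕ) : Submodule 𝕜 H :=
  Submodule.span 𝕜 {v | ∃ k < N, v = val (npow A k) r}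

/-- The affine space `f₀ + K_N(A, A f₀ - g)`. -/
def searchSpace (A : H →ₗ.[𝕜] H) (g f₀ : H) (N : ℕ) : Set H :=
  {h | h - f₀ ∈ krylov A (val A f₀ - g) N}

/-- `f` is the sequence of `θ`-iterates for `A f = g` with initial guess `f₀`: `f 0 = f₀`, and for
every `N ≥ 1`, `f N` minimises `‖A ^ (θ / 2) (h - P_S h)‖` over `h ∈ f₀ + K_N(A, A f₀ - g)`, where
`h - P_S h` is in the domain of `A ^ (θ / 2)` for all these `h`. -/
def IsThetaIterates (A : H →ₗ.[𝕜] H) (g f₀ : H) (θ : ℝ) (f : ℕ → H) : Prop :=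
  f 0 = f₀ ∧ ∀ N : ℕ, 1 ≤ N →
    (∀ h ∈ searchSpace A g f₀ N, err A g h ∈ (rpow A (θ / 2)).domain) ∧
    f N ∈ searchSpace A g f₀ N ∧
    ∀ h ∈ searchSpace A g f₀ N,
      ‖val (rpow A (θ / 2)) (err A g (f N))‖ ≤ ‖val (rpow A (θ / 2)) (err A g h)‖

end UnboundedOp

end

noncomputable section

namespace UnboundedOp

section PowersAndSmoothVectors

variable {𝕜 : Type*} [RCLike 𝕜] {H : Type*} [NormedAddCommGroup H] [InnerProductSpace 𝕜 H]

/-! ### Products and powers of operators -/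

/-! Let `q` be the solution with `e = f₀ - q ⊥ ker A`. Since `A q = g` is smooth, so is `e`, and `A
f₀ - g = A e`. Hence the search space is `f₀ + K` with `K` spanned by `A e, …, A ^ N e`. These
vectors lie in `ran A ⊆ (ker A)ᗮ`, so each `h = f₀ + k` has `P_S h = q` and `h - P_S h = e + k ⊥ ker
A`. Claims 1 and 2 follow.

What remains is a finite-dimensional least-squares problem: minimise `‖A ^ (θ / 2) (e + k)‖` over `k
∈ K`. On smooth vectors a power of `A` kills nothing outside `ker A`, so it is injective on `K`, and
the minimiser exists and is unique (`exists_minimizer`). For claim 3 the coefficients must be real: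
the moments `⟨A ^ i w, A ^ j w⟩` are real, so taking real parts of the coefficients does not
increase the norm (`norm_sum_re_le`), and uniqueness forces them to be real already.

The analysis concerns `A ^ s` on smooth vectors: they lie in its domain, it commutes with `A`, and
its kernel is controlled. No spectral theorem is needed. The estimates `‖A y‖, t ‖y‖ ≤ ‖(t + A) y‖`
give the resolvent, and the Balakrishnan integral gives the rest (`fracPow_comm`,
`val_eq_zero_of_fracPow_eq_zero`). -/

theorem val_sub (B : H →ₗ.[𝕜] H) {x y : H} (hx : x ∈ B.domain) (hy : y ∈ B.domain) :
    val B (x - y) = val B x - val B y := by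
  rw [val_of_mem B hx, val_of_mem B hy, val_of_mem B (B.domain.sub_mem hx hy), ← B.map_sub]
  rfl

theorem mem_comp_domain {B A : H →ₗ.[𝕜] H} {x : H} :
    x ∈ (comp B A).domain ↔ x ∈ A.domain ∧ val A x ∈ B.domain := by
  change x ∈ compDomain B A ⊓ A.domain ↔ _
  simp only [compDomain, Submodule.mem_inf, Submodule.mem_map, Submodule.mem_comap]
  constructor
  · rintro ⟨⟨y, hy, rfl⟩, -⟩
    refine ⟨y.2, ?_⟩
    rw [Submodule.subtype_apply, val_of_mem A y.2]
    exact hy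
  · rintro ⟨hx, hx'⟩
    rw [val_of_mem A hx] at hx'
    exact ⟨⟨⟨x, hx⟩, hx', rfl⟩, hx⟩

theorem val_comp {B A : H →ₗ.[𝕜] H} {x : H} (hx : x ∈ A.domain) (hAx : val A x ∈ B.domain) :
    val (comp B A) x = val B (val A x) := by
  rw [val_of_mem _ (mem_comp_domain.2 ⟨hx, hAx⟩)]
  -- The membership proof depends on the vector, so the equality is generalised to a variable `y`
  -- and then substituted.
  have key : ∀ (y : H) (hy : y ∈ B.domain), A ⟨x, hx⟩ = y → B ⟨A ⟨x, hx⟩, by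
      rw [val_of_mem A hx] at hAx; exact hAx⟩ = B ⟨y, hy⟩ := by
    rintro y hy rfl; rfl
  rw [val_of_mem _ hAx]
  exact key _ hAx (val_of_mem A hx).symm

theorem mem_npow_zero (A : H →ₗ.[𝕜] H) (x : H) : x ∈ (npow A 0).domain := Submodule.mem_top

theorem val_npow_zero (A : H →ₗ.[𝕜] H) (x : H) : val (npow A 0) x = x :=
  val_of_mem _ (mem_npow_zero A x)

theorem mem_npow_succ {A : H →ₗ.[𝕜] H} {n : ℕ} {x : H} :
    x ∈ (npow A (n + 1)).domain ↔ x ∈ (npow A n).domain ∧ val (npow A n) x ∈ A.domain :=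
  mem_comp_domain

/-- `npow` applies the extra factor `A` last; this moves it first. Domain and value share one
induction because each needs the other at the previous stage. -/
theorem npow_succ_left_aux (A : H →ₗ.[𝕜] H) (n : ℕ) (x : H) :
    (x ∈ (npow A (n + 1)).domain ↔ x ∈ A.domain ∧ val A x ∈ (npow A n).domain) ∧
    (x ∈ (npow A (n + 1)).domain → val (npow A (n + 1)) x = val (npow A n) (val A x)) := by
  induction n with
  | zero =>
    have h : x ∈ (npow A 1).domain ↔ x ∈ A.domain := by
      rw [mem_npow_succ, val_npow_zero]
      simp [mem_npow_zero]
    refine ⟨by simpa [mem_npow_zero] using h, fun hx => ?_⟩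
    have hx' := h.1 hx
    change val (comp A (npow A 0)) x = _
    rw [val_comp (mem_npow_zero A x) (by rwa [val_npow_zero]), val_npow_zero, val_npow_zero]
  | succ n ih =>
    constructor
    · rw [mem_npow_succ (n := n + 1), mem_npow_succ (n := n) (x := val A x)]
      constructor
      · rintro ⟨h1, h2⟩
        rw [ih.2 h1] at h2
        exact ⟨(ih.1.1 h1).1, (ih.1.1 h1).2, h2⟩
      · rintro ⟨h1, h2, h3⟩
        have := ih.1.2 ⟨h1, h2⟩
        exact ⟨this, by rwa [ih.2 this]⟩
    · intro h
      have h' := mem_npow_succ.1 h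
      have h'' := ih.1.1 h'.1
      change val (comp A (npow A (n + 1))) x = val (comp A (npow A n)) (val A x)
      rw [val_comp h'.1 h'.2, ih.2 h'.1, val_comp h''.2]
      rw [← ih.2 h'.1]
      exact h'.2

theorem mem_npow_succ_left {A : H →ₗ.[𝕜] H} {n : ℕ} {x : H} :
    x ∈ (npow A (n + 1)).domain ↔ x ∈ A.domain ∧ val A x ∈ (npow A n).domain :=
  (npow_succ_left_aux A n x).1

theorem val_npow_succ_left {A : H →ₗ.[𝕜] H} {n : ℕ} {x : H} (hx : x ∈ (npow A (n + 1)).domain) :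
    val (npow A (n + 1)) x = val (npow A n) (val A x) :=
  (npow_succ_left_aux A n x).2 hx

theorem val_npow_succ {A : H →ₗ.[𝕜] H} {n : ℕ} {x : H} (hx : x ∈ (npow A (n + 1)).domain) :
    val (npow A (n + 1)) x = val A (val (npow A n) x) :=
  val_comp (mem_npow_succ.1 hx).1 (mem_npow_succ.1 hx).2

/-! ### Smooth vectors -/

theorem mem_smoothVectors {A : H →ₗ.[𝕜] H} {x : H} :
    x ∈ smoothVectors A ↔ ∀ n, x ∈ (npow A n).domain := by
  simp [smoothVectors]

theorem mem_smoothVectors_iff {A : H →ₗ.[𝕜] H} {x : H} :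
    x ∈ smoothVectors A ↔ x ∈ A.domain ∧ val A x ∈ smoothVectors A := by
  simp only [mem_smoothVectors]
  constructor
  · intro h
    exact ⟨(mem_npow_succ_left.1 (h 1)).1, fun n => (mem_npow_succ_left.1 (h (n + 1))).2⟩
  · rintro ⟨h1, h2⟩ (_ | n)
    · exact mem_npow_zero A x
    · exact mem_npow_succ_left.2 ⟨h1, h2 n⟩

theorem smoothVectors_le_domain (A : H →ₗ.[𝕜] H) : smoothVectors A ≤ A.domain :=
  fun _ hx => (mem_smoothVectors_iff.1 hx).1

theorem val_mem_smoothVectors {A : H →ₗ.[𝕜] H} {x : H} (hx : x ∈ smoothVectors A) :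
    val A x ∈ smoothVectors A :=
  (mem_smoothVectors_iff.1 hx).2

/-- The restriction of an operator to an invariant subspace of its domain. -/
def restrict (B : H →ₗ.[𝕜] H) (V : Submodule 𝕜 H) (hV : V ≤ B.domain)
    (hB : ∀ x ∈ V, val B x ∈ V) : V →ₗ[𝕜] V where
  toFun x := ⟨val B x, hB x x.2⟩
  map_add' x y := Subtype.ext (val_add B (hV x.2) (hV y.2))
  map_smul' c x := Subtype.ext (val_smul B c (hV x.2))

/-- The operator `A` on its smooth vectors. -/
def smoothMap (A : H →ₗ.[𝕜] H) : smoothVectors A →ₗ[𝕜] smoothVectors A :=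
  restrict A (smoothVectors A) (smoothVectors_le_domain A) fun _ => val_mem_smoothVectors

theorem coe_smoothMap (A : H →ₗ.[𝕜] H) (x : smoothVectors A) :
    (smoothMap A x : H) = val A x := rfl

theorem val_npow_coe (A : H →ₗ.[𝕜] H) (n : ℕ) (x : smoothVectors A) :
    val (npow A n) x = ((smoothMap A ^ n) x : smoothVectors A) := by
  induction n with
  | zero => exact val_npow_zero A x
  | succ n ih =>
    rw [val_npow_succ (mem_smoothVectors.1 x.2 _), ih, pow_succ']
    rfl

theorem mem_ker_iff {A : H →ₗ.[𝕜] H} {x : H} : x ∈ ker A ↔ x ∈ A.domain ∧ val A x = 0 := by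
  simp only [ker, Submodule.mem_map, LinearMap.mem_ker]
  constructor
  · rintro ⟨y, hy, rfl⟩
    exact ⟨y.2, (val_of_mem A y.2).trans hy⟩
  · rintro ⟨hx, hx'⟩
    exact ⟨⟨x, hx⟩, (val_of_mem A hx).symm.trans hx', rfl⟩

theorem mem_solutionSet_iff {A : H →ₗ.[𝕜] H} {g x : H} :
    x ∈ solutionSet A g ↔ x ∈ A.domain ∧ val A x = g := by
  constructor
  · rintro ⟨hx, rfl⟩
    exact ⟨hx, val_of_mem A hx⟩
  · rintro ⟨hx, rfl⟩
    exact ⟨hx, (val_of_mem A hx).symm⟩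

/-! ### Polynomials of an operator on smooth vectors -/

theorem polyOp_smooth (p : Polynomial ℝ) (A : H →ₗ.[𝕜] H) (x : smoothVectors A) :
    ∃ h : (x : H) ∈ (polyOp p A).domain,
      polyOp p A ⟨x, h⟩ = ((p.sum fun k a => (a : 𝕜) • (smoothMap A ^ k) x :
        smoothVectors A) : H) := by
  -- `polyOp` is a sum over `p.support`; induction needs arbitrary index sets. The empty sum has
  -- domain `⊤`.
  have key : ∀ s : Finset ℕ,
      ∃ h : (x : H) ∈ (∑ k ∈ s, ((p.coeff k : ℝ) : 𝕜) • npow A k).domain,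
        (∑ k ∈ s, ((p.coeff k : ℝ) : 𝕜) • npow A k) ⟨x, h⟩ =
          ((∑ k ∈ s, ((p.coeff k : ℝ) : 𝕜) • (smoothMap A ^ k) x : smoothVectors A) : H) := by
    classical
    intro s
    induction s using Finset.induction_on with
    | empty => exact ⟨Submodule.mem_top, by simp⟩
    | insert a s ha ih =>
      obtain ⟨h1, h2⟩ := ih
      have h3 : (x : H) ∈ (((p.coeff a : ℝ) : 𝕜) • npow A a).domain := mem_smoothVectors.1 x.2 a
      rw [Finset.sum_insert ha, Finset.sum_insert ha]
      refine ⟨Submodule.mem_inf.2 ⟨h3, h1⟩, ?_⟩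
      rw [LinearPMap.add_apply, Submodule.coe_add, ← h2, Submodule.coe_smul, ← val_npow_coe,
        val_of_mem _ (mem_smoothVectors.1 x.2 a)]
      rfl
  exact key p.support

end PowersAndSmoothVectors

section Resolvent

variable {𝕜 : Type*} [RCLike 𝕜] {H : Type*} [NormedAddCommGroup H] [InnerProductSpace 𝕜 H]
variable {A : H →ₗ.[𝕜] H}

/-! ### Self-adjoint operators and their resolvents -/

theorem re_inner_val_nonneg (hpos : IsNonneg A) {x : H} (hx : x ∈ A.domain) :
    0 ≤ RCLike.re (inner 𝕜 x (val A x)) := by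
  rw [val_of_mem A hx]
  exact hpos ⟨x, hx⟩

/-- The cross term `2 t Re ⟨y, A y⟩` is non-negative. All resolvent bounds come from this. -/
theorem sq_norm_le_sq_norm_shift (hpos : IsNonneg A) {t : ℝ} (ht : 0 < t) {y : H}
    (hy : y ∈ A.domain) :
    (t * ‖y‖) ^ 2 + ‖val A y‖ ^ 2 ≤ ‖(t : 𝕜) • y + val A y‖ ^ 2 := by
  rw [@norm_add_sq 𝕜, inner_smul_left, norm_smul, RCLike.conj_ofReal, RCLike.re_ofReal_mul,
    RCLike.norm_ofReal, abs_of_pos ht]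
  have := mul_nonneg ht.le (re_inner_val_nonneg hpos hy)
  linarith

theorem norm_val_le_norm_shift (hpos : IsNonneg A) {t : ℝ} (ht : 0 < t) {y : H}
    (hy : y ∈ A.domain) : ‖val A y‖ ≤ ‖(t : 𝕜) • y + val A y‖ := by
  have := sq_norm_le_sq_norm_shift hpos ht hy
  exact le_of_abs_le (abs_le_of_sq_le_sq (by nlinarith [sq_nonneg (t * ‖y‖)]) (norm_nonneg _))

theorem norm_le_norm_shift (hpos : IsNonneg A) {t : ℝ} (ht : 0 < t) {y : H}
    (hy : y ∈ A.domain) : t * ‖y‖ ≤ ‖(t : 𝕜) • y + val A y‖ := by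
  have := sq_norm_le_sq_norm_shift hpos ht hy
  exact le_of_abs_le (abs_le_of_sq_le_sq (by nlinarith [sq_nonneg ‖val A y‖]) (norm_nonneg _))

/-- The map `t + A` on the domain of `A`. -/
def shiftMap (A : H →ₗ.[𝕜] H) (t : ℝ) : A.domain →ₗ[𝕜] H :=
  (((t : 𝕜) • (LinearMap.id : H →ₗ[𝕜] H)) +ᵥ A).toFun

theorem shiftMap_apply (t : ℝ) (y : A.domain) : shiftMap A t y = (t : 𝕜) • (y : H) + val A y := by
  rw [val_of_mem A y.2]
  rfl

theorem resolventPart_of_shift_eq (hpos : IsNonneg A) {t : ℝ} (ht : 0 < t) {x y : H}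
    (hy : y ∈ A.domain) (hyx : (t : 𝕜) • y + val A y = x) :
    x ∈ (resolventPart A t).domain ∧ val (resolventPart A t) x = val A y := by
  set T : H →ₗ.[𝕜] H := ((t : 𝕜) • (LinearMap.id : H →ₗ[𝕜] H)) +ᵥ A with hT
  have hker : LinearMap.ker T.toFun = ⊥ := by
    rw [LinearMap.ker_eq_bot']
    intro z hz
    have h := norm_le_norm_shift hpos ht (y := (z : H)) z.2
    rw [← shiftMap_apply t (⟨z, z.2⟩ : A.domain)] at h
    change t * _ ≤ ‖T.toFun z‖ at h
    rw [hz, norm_zero] at h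
    exact Subtype.ext (norm_le_zero_iff.1 (nonpos_of_mul_nonpos_right h ht))
  have hTy : T ⟨y, hy⟩ = x := by
    rw [← hyx, ← shiftMap_apply t (⟨y, hy⟩ : A.domain)]
    rfl
  have hx : x ∈ T.inverse.domain := by
    rw [LinearPMap.inverse_domain]
    exact ⟨⟨y, hy⟩, hTy⟩
  have hv : val T.inverse x = y := by
    rw [val_of_mem _ hx]
    exact LinearPMap.inverse_apply_eq hker (x := ⟨y, hy⟩) hTy
  have hv' : val T.inverse x ∈ A.domain := by rwa [hv]
  exact ⟨mem_comp_domain.2 ⟨hx, hv'⟩, by rw [resolventPart, val_comp hx hv', hv]⟩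

variable [CompleteSpace H]

theorem inner_val_left (hA : IsSelfAdjoint A) {x y : H} (hx : x ∈ A.domain) (hy : y ∈ A.domain) :
    inner 𝕜 (val A x) y = inner 𝕜 x (val A y) := by
  have h := LinearPMap.adjoint_isFormalAdjoint hA.dense_domain
  rw [LinearPMap.isSelfAdjoint_def.1 hA] at h
  rw [val_of_mem A hx, val_of_mem A hy]
  exact h ⟨x, hx⟩ ⟨y, hy⟩

/-- This is `D(A*) ⊆ D(A)` in weak form; it replaces closedness of `A` whenever a limit has to be
placed in `D(A)`. -/
theorem mem_domain_of_inner (hA : IsSelfAdjoint A) {y z : H}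
    (h : ∀ u ∈ A.domain, inner 𝕜 z u = inner 𝕜 y (val A u)) : y ∈ A.domain ∧ val A y = z := by
  have h' : ∀ u : A.domain, inner 𝕜 z (u : H) = inner 𝕜 y (A u) := fun u => by
    rw [h u u.2, val_of_mem A u.2]
  have hy : y ∈ A.domain := by
    have := LinearPMap.mem_adjoint_domain_of_exists (T := A) y ⟨z, h'⟩
    rwa [LinearPMap.isSelfAdjoint_def.1 hA] at this
  refine ⟨hy, hA.dense_domain.eq_of_inner_left 𝕜 fun u hu => ?_⟩
  rw [inner_val_left hA hy hu, h u hu]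

/-- The bound `t ‖y‖ ≤ ‖(t + A) y‖` makes preimages of a convergent sequence Cauchy; their limit is
a preimage of the limit by the weak form. -/
theorem isClosed_range_shiftMap (hA : IsSelfAdjoint A) (hpos : IsNonneg A) {t : ℝ} (ht : 0 < t) :
    IsClosed (LinearMap.range (shiftMap A t) : Set H) := by
  refine isClosed_of_closure_subset fun x hx => ?_
  obtain ⟨u, hu, hux⟩ := mem_closure_iff_seq_limit.1 hx
  choose y hy using hu
  have hc : CauchySeq (fun n => (y n : H)) := by
    rw [Metric.cauchySeq_iff]
    intro ε hε
    obtain ⟨N, hN⟩ := Metric.cauchySeq_iff.1 hux.cauchySeq (t * ε) (by positivity)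
    refine ⟨N, fun m hm n hn => ?_⟩
    have h1 := hN m hm n hn
    have h2 := norm_le_norm_shift hpos ht (y m - y n).2
    rw [← shiftMap_apply, map_sub, hy, hy, Submodule.coe_sub] at h2
    rw [dist_eq_norm] at h1 ⊢
    exact lt_of_mul_lt_mul_left (h2.trans_lt h1) ht.le
  obtain ⟨z, hz⟩ := cauchySeq_tendsto_of_complete hc
  have hval : Tendsto (fun n => val A (y n)) atTop (𝓝 (x - (t : 𝕜) • z)) := by
    have : (fun n => val A (y n)) = fun n => u n - (t : 𝕜) • (y n : H) := by
      funext n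
      rw [← hy n, shiftMap_apply, add_sub_cancel_left]
    rw [this]
    exact hux.sub (hz.const_smul _)
  obtain ⟨h1, h2⟩ := mem_domain_of_inner hA (y := z) (z := x - (t : 𝕜) • z) fun v hv => by
    refine tendsto_nhds_unique (hval.inner tendsto_const_nhds) ?_
    simp only [inner_val_left hA (y _).2 hv]
    exact hz.inner tendsto_const_nhds
  exact ⟨⟨z, h1⟩, by rw [shiftMap_apply, h2]; abel⟩

/-- A vector `w` orthogonal to the closed range satisfies `A w = -t w`, and the lower bound then
gives `w = 0`. -/
theorem exists_shift_eq (hA : IsSelfAdjoint A) (hpos : IsNonneg A) {t : ℝ} (ht : 0 < t) (x : H) :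
    ∃ y ∈ A.domain, (t : 𝕜) • y + val A y = x := by
  have hcl := isClosed_range_shiftMap hA hpos ht
  have : CompleteSpace (LinearMap.range (shiftMap A t)) := hcl.completeSpace_coe
  have htop : LinearMap.range (shiftMap A t) = ⊤ := by
    rw [← Submodule.orthogonal_eq_bot_iff, Submodule.eq_bot_iff]
    intro w hw
    obtain ⟨h1, h2⟩ := mem_domain_of_inner hA (y := w) (z := -((t : 𝕜) • w)) fun v hv => by
      have h := Submodule.inner_left_of_mem_orthogonal (𝕜 := 𝕜)
        (LinearMap.mem_range_self (shiftMap A t) ⟨v, hv⟩) hw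
      rw [shiftMap_apply, inner_add_right, inner_smul_right] at h
      rw [inner_neg_left, inner_smul_left, RCLike.conj_ofReal]
      exact neg_eq_of_add_eq_zero_right h
    have h3 := norm_le_norm_shift hpos ht h1
    rw [h2, add_neg_cancel, norm_zero] at h3
    exact norm_le_zero_iff.1 (nonpos_of_mul_nonpos_right h3 ht)
  obtain ⟨y, hy⟩ : x ∈ LinearMap.range (shiftMap A t) := htop ▸ Submodule.mem_top
  exact ⟨y, y.2, by rw [← hy, shiftMap_apply]⟩

theorem mem_resolventPart_domain (hA : IsSelfAdjoint A) (hpos : IsNonneg A) {t : ℝ} (ht : 0 < t)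
    (x : H) : x ∈ (resolventPart A t).domain := by
  obtain ⟨y, hy, hyx⟩ := exists_shift_eq hA hpos ht x
  exact (resolventPart_of_shift_eq hpos ht hy hyx).1

theorem norm_resolventPart_le (hA : IsSelfAdjoint A) (hpos : IsNonneg A) {t : ℝ} (ht : 0 < t)
    (x : H) : ‖val (resolventPart A t) x‖ ≤ ‖x‖ := by
  obtain ⟨y, hy, hyx⟩ := exists_shift_eq hA hpos ht x
  rw [(resolventPart_of_shift_eq hpos ht hy hyx).2, ← hyx]
  exact norm_val_le_norm_shift hpos ht hy

theorem sq_norm_resolventPart_le_re_inner (hA : IsSelfAdjoint A) (hpos : IsNonneg A) {t : ℝ}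
    (ht : 0 < t) (x : H) :
    ‖val (resolventPart A t) x‖ ^ 2 ≤ RCLike.re (inner 𝕜 x (val (resolventPart A t) x)) := by
  obtain ⟨y, hy, hyx⟩ := exists_shift_eq hA hpos ht x
  rw [(resolventPart_of_shift_eq hpos ht hy hyx).2]
  rw [← hyx]
  rw [inner_add_left, inner_smul_left, RCLike.conj_ofReal, map_add, RCLike.re_ofReal_mul,
    inner_self_eq_norm_sq]
  exact le_add_of_nonneg_left (mul_nonneg ht.le (re_inner_val_nonneg hpos hy))

theorem val_eq_zero_of_resolventPart_eq_zero (hA : IsSelfAdjoint A) (hpos : IsNonneg A) {t : ℝ}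
    (ht : 0 < t) {x : H} (h : val (resolventPart A t) x = 0) : val A x = 0 := by
  obtain ⟨y, hy, hyx⟩ := exists_shift_eq hA hpos ht x
  rw [(resolventPart_of_shift_eq hpos ht hy hyx).2] at h
  rw [← hyx, h, add_zero, val_smul A _ hy, h, smul_zero]

/-- With `(t + A) y = x`, the vector `A y = x - t y` is in `D(A)` and solves `(t + A) (A y) = A x`.
The last clause is the decay `O(1 / t)` that makes the Balakrishnan integral converge at infinity.
-/
theorem resolventPart_comm (hA : IsSelfAdjoint A) (hpos : IsNonneg A) {t : ℝ} (ht : 0 < t)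
    {x : H} (hx : x ∈ A.domain) :
    val (resolventPart A t) x ∈ A.domain ∧
      val A (val (resolventPart A t) x) = val (resolventPart A t) (val A x) ∧
      t * ‖val (resolventPart A t) x‖ ≤ ‖val A x‖ := by
  obtain ⟨y, hy, hyx⟩ := exists_shift_eq hA hpos ht x
  have hv : val A y = x - (t : 𝕜) • y := by rw [← hyx, add_sub_cancel_left]
  have hmem : val A y ∈ A.domain := by
    rw [hv]
    exact A.domain.sub_mem hx (A.domain.smul_mem _ hy)
  have hshift : (t : 𝕜) • val A y + val A (val A y) = val A x := by
    rw [← hyx, val_add A (A.domain.smul_mem _ hy) hmem, val_smul A _ hy]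
  rw [(resolventPart_of_shift_eq hpos ht hy hyx).2,
    (resolventPart_of_shift_eq hpos ht hmem hshift).2]
  refine ⟨hmem, rfl, ?_⟩
  rw [← hshift]
  exact norm_le_norm_shift hpos ht hmem

theorem norm_resolventPart_sub_le (hA : IsSelfAdjoint A) (hpos : IsNonneg A) {s t : ℝ}
    (hs : 0 < s) (ht : 0 < t) (x : H) :
    ‖val (resolventPart A t) x - val (resolventPart A s) x‖ ≤ |t - s| * (‖x‖ / s) := by
  obtain ⟨y, hy, hyx⟩ := exists_shift_eq hA hpos ht x
  obtain ⟨z, hz, hzx⟩ := exists_shift_eq hA hpos hs x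
  rw [(resolventPart_of_shift_eq hpos ht hy hyx).2, (resolventPart_of_shift_eq hpos hs hz hzx).2,
    ← val_sub A hy hz]
  refine (norm_val_le_norm_shift hpos ht (A.domain.sub_mem hy hz)).trans ?_
  -- The resolvent identity, obtained by subtracting the two shifted equations for the same `x`.
  have h : (t : 𝕜) • (y - z) + val A (y - z) = ((s - t : ℝ) : 𝕜) • z := by
    rw [val_sub A hy hz, smul_sub, RCLike.ofReal_sub, sub_smul]
    have := hyx.trans hzx.symm
    rw [sub_add_sub_comm, this]
    abel
  rw [h, norm_smul, RCLike.norm_ofReal, abs_sub_comm]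
  refine mul_le_mul_of_nonneg_left ?_ (abs_nonneg _)
  rw [le_div_iff₀ hs, mul_comm, ← hzx]
  exact norm_le_norm_shift hpos hs hz

theorem continuousOn_resolventPart (hA : IsSelfAdjoint A) (hpos : IsNonneg A) (x : H) :
    ContinuousOn (fun t => val (resolventPart A t) x) (Set.Ioi 0) := by
  intro s hs
  rw [ContinuousWithinAt, tendsto_iff_norm_sub_tendsto_zero]
  have hlim : Tendsto (fun t : ℝ => |t - s| * (‖x‖ / s)) (𝓝[Set.Ioi 0] s) (𝓝 0) := by
    have : Continuous fun t : ℝ => |t - s| * (‖x‖ / s) := by fun_prop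
    have h := this.tendsto s
    simp only [sub_self, abs_zero, zero_mul] at h
    exact h.mono_left nhdsWithin_le_nhds
  refine squeeze_zero' (Eventually.of_forall fun _ => norm_nonneg _) ?_ hlim
  filter_upwards [self_mem_nhdsWithin] with t ht
  exact norm_resolventPart_sub_le hA hpos hs ht x

end Resolvent

section FractionalPowers

variable {𝕜 : Type*} [RCLike 𝕜] {H : Type*} [NormedAddCommGroup H] [InnerProductSpace 𝕜 H]
variable [CompleteSpace H] {A : H →ₗ.[𝕜] H} {α : ℝ}

/-! ### Fractional powers -/

omit [CompleteSpace H] in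
theorem norm_balakrishnanIntegrand {t : ℝ} (ht : 0 < t) (x : H) :
    ‖balakrishnanIntegrand A α x t‖ = t ^ (α - 1) * ‖val (resolventPart A t) x‖ := by
  rw [balakrishnanIntegrand, norm_smul, RCLike.norm_ofReal, abs_of_pos (Real.rpow_pos_of_pos ht _)]

theorem aestronglyMeasurable_balakrishnanIntegrand (hA : IsSelfAdjoint A) (hpos : IsNonneg A)
    (x : H) {s : Set ℝ} (hs : s ⊆ Set.Ioi 0) (hs' : MeasurableSet s) :
    AEStronglyMeasurable (balakrishnanIntegrand A α x) (volume.restrict s) := by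
  refine (ContinuousOn.smul ?_ ?_).aestronglyMeasurable hs'
  · refine RCLike.continuous_ofReal.comp_continuousOn ?_
    exact continuousOn_id.rpow_const fun t ht => Or.inl (hs ht).ne'
  · exact (continuousOn_resolventPart hA hpos x).mono hs

theorem integrableOn_balakrishnanIntegrand_Ioc (hA : IsSelfAdjoint A) (hpos : IsNonneg A)
    (hα : 0 < α) (x : H) (R : ℝ) :
    IntegrableOn (balakrishnanIntegrand A α x) (Set.Ioc 0 R) := by
  rcases le_total R 0 with hR | hR
  · rw [Set.Ioc_eq_empty_of_le hR]
    exact integrableOn_empty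
  have h : IntegrableOn (fun t : ℝ => t ^ (α - 1) * ‖x‖) (Set.Ioc 0 R) := by
    refine Integrable.mul_const ?_ _
    exact (intervalIntegrable_iff_integrableOn_Ioc_of_le hR).1
      (intervalIntegral.intervalIntegrable_rpow' (by linarith))
  refine Integrable.mono' h (aestronglyMeasurable_balakrishnanIntegrand hA hpos x
    Set.Ioc_subset_Ioi_self measurableSet_Ioc) ?_
  filter_upwards [ae_restrict_mem measurableSet_Ioc] with t ht
  rw [norm_balakrishnanIntegrand ht.1]
  exact mul_le_mul_of_nonneg_left (norm_resolventPart_le hA hpos ht.1 x)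
    (Real.rpow_nonneg ht.1.le _)

/-- Near `0` the bound `t ^ (α - 1) ‖x‖` suffices, as `α > 0`; at infinity the decay for `x ∈ D(A)`
gives `t ^ (α - 2) ‖A x‖`, integrable as `α < 1`. -/
theorem integrableOn_balakrishnanIntegrand_Ioi (hA : IsSelfAdjoint A) (hpos : IsNonneg A)
    (hα : 0 < α) (hα' : α < 1) {x : H} (hx : x ∈ A.domain) :
    IntegrableOn (balakrishnanIntegrand A α x) (Set.Ioi 0) := by
  rw [← Set.Ioc_union_Ioi_eq_Ioi (zero_le_one' ℝ)]
  refine (integrableOn_balakrishnanIntegrand_Ioc hA hpos hα x 1).union ?_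
  have h : IntegrableOn (fun t : ℝ => t ^ (α - 2) * ‖val A x‖) (Set.Ioi 1) := by
    refine Integrable.mul_const ?_ _
    exact integrableOn_Ioi_rpow_of_lt (by linarith) one_pos
  refine Integrable.mono' h (aestronglyMeasurable_balakrishnanIntegrand hA hpos x
    (Set.Ioi_subset_Ioi zero_le_one) measurableSet_Ioi) ?_
  filter_upwards [ae_restrict_mem measurableSet_Ioi] with t ht
  have ht' : 0 < t := zero_lt_one.trans ht
  rw [norm_balakrishnanIntegrand ht', show α - 1 = α - 2 + 1 by ring,
    Real.rpow_add_one ht'.ne', mul_assoc]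
  exact mul_le_mul_of_nonneg_left (resolventPart_comm hA hpos ht' hx).2.2
    (Real.rpow_nonneg ht'.le _)

theorem domain_le_fracPow_domain (hA : IsSelfAdjoint A) (hpos : IsNonneg A) (hα : 0 < α)
    (hα' : α < 1) : A.domain ≤ (fracPow A α).domain := fun x hx => by
  let _ : NormedSpace ℝ H := NormedSpace.restrictScalars ℝ 𝕜 H
  refine ⟨fun t ht => mem_resolventPart_domain hA hpos ht x,
    integrableOn_balakrishnanIntegrand_Ioc hA hpos hα x,
    ∫ t in Set.Ioi 0, balakrishnanIntegrand A α x t, ?_⟩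
  refine (intervalIntegral_tendsto_integral_Ioi 0
    (integrableOn_balakrishnanIntegrand_Ioi hA hpos hα hα' hx) tendsto_id).congr' ?_
  filter_upwards [eventually_ge_atTop 0] with R hR
  exact intervalIntegral.integral_of_le hR

omit [CompleteSpace H] in
theorem tendsto_fracPow {x : H} (hx : x ∈ (fracPow A α).domain) :
    Tendsto (fun R => ((Real.sin (Real.pi * α) / Real.pi : ℝ) : 𝕜) • balakrishnanIntegral A α x R)
      atTop (𝓝 (val (fracPow A α) x)) := by
  obtain ⟨y, hy⟩ := hx.2.2
  rw [val_of_mem _ hx]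
  change Tendsto _ _ (𝓝 (((Real.sin (Real.pi * α) / Real.pi : ℝ) : 𝕜) •
    limUnder atTop (balakrishnanIntegral A α x)))
  rw [hy.limUnder_eq]
  exact hy.const_smul _

theorem inner_balakrishnanIntegral (hA : IsSelfAdjoint A) (hpos : IsNonneg A)
    (hα : 0 < α) (u x : H) (R : ℝ) :
    inner 𝕜 u (balakrishnanIntegral A α x R) =
      ∫ t in Set.Ioc 0 R, inner 𝕜 u (balakrishnanIntegrand A α x t) := by
  let _ : NormedSpace ℝ H := NormedSpace.restrictScalars ℝ 𝕜 H
  have : IsScalarTower ℝ 𝕜 H := RestrictScalars.isScalarTower ℝ 𝕜 H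
  exact (integral_inner (integrableOn_balakrishnanIntegrand_Ioc hA hpos hα x R) u).symm

/-- Tested against `u ∈ D(A)`, the operator `A` passes under the scalar integral and there commutes
with the resolvent. -/
theorem fracPow_comm (hA : IsSelfAdjoint A) (hpos : IsNonneg A) (hα : 0 < α) (hα' : α < 1)
    {x : H} (hx : x ∈ A.domain) (hAx : val A x ∈ A.domain) :
    val (fracPow A α) x ∈ A.domain ∧ val A (val (fracPow A α) x) = val (fracPow A α) (val A x) := by
  have hle := domain_le_fracPow_domain hA hpos hα hα'
  refine mem_domain_of_inner hA fun u hu => ?_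
  have h1 := (tendsto_fracPow (hle hAx)).inner (𝕜 := 𝕜) (tendsto_const_nhds (x := u))
  have h2 := (tendsto_fracPow (hle hx)).inner (𝕜 := 𝕜) (tendsto_const_nhds (x := val A u))
  refine tendsto_nhds_unique h1 (h2.congr fun R => ?_)
  rw [inner_smul_left, inner_smul_left]
  congr 1
  -- Conjugate symmetry moves the integral to the second slot, where `inner_balakrishnanIntegral`
  -- applies.
  rw [← inner_conj_symm, ← inner_conj_symm _ u]
  congr 1
  rw [inner_balakrishnanIntegral hA hpos hα, inner_balakrishnanIntegral hA hpos hα]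
  refine setIntegral_congr_fun measurableSet_Ioc fun t ht => ?_
  have h := resolventPart_comm hA hpos ht.1 hx
  simp only [balakrishnanIntegrand]
  rw [inner_smul_right, inner_smul_right, inner_val_left hA hu h.1, h.2.1]

/-- Up to a positive constant, `Re ⟨x, A ^ α x⟩` is the increasing limit of integrals of `φ t ≥ t ^
(α - 1) ‖A (t + A)⁻¹ x‖ ^ 2`. If it vanishes, so does `φ` almost everywhere on `(0, 1]`. -/
theorem val_eq_zero_of_fracPow_eq_zero (hA : IsSelfAdjoint A) (hpos : IsNonneg A) (hα : 0 < α)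
    (hα' : α < 1) {x : H} (hx : x ∈ (fracPow A α).domain) (h : val (fracPow A α) x = 0) :
    val A x = 0 := by
  have hsin : 0 < Real.sin (Real.pi * α) / Real.pi :=
    div_pos (Real.sin_pos_of_pos_of_lt_pi (by positivity)
      (by nlinarith [Real.pi_pos])) Real.pi_pos
  set φ : ℝ → ℝ := fun t => RCLike.re (inner 𝕜 x (balakrishnanIntegrand A α x t)) with hφ
  have hφ0 : ∀ t, 0 < t → t ^ (α - 1) * ‖val (resolventPart A t) x‖ ^ 2 ≤ φ t := fun t ht => by
    simp only [hφ, balakrishnanIntegrand]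
    rw [inner_smul_right, RCLike.re_ofReal_mul]
    exact mul_le_mul_of_nonneg_left (sq_norm_resolventPart_le_re_inner hA hpos ht x)
      (Real.rpow_nonneg ht.le _)
  have hφnn : ∀ t, 0 < t → 0 ≤ φ t := fun t ht =>
    (mul_nonneg (Real.rpow_nonneg ht.le _) (sq_nonneg _)).trans (hφ0 t ht)
  have hint : ∀ R, IntegrableOn φ (Set.Ioc 0 R) := fun R =>
    ((integrableOn_balakrishnanIntegrand_Ioc hA hpos hα x R).const_inner x).re
  have hre : ∀ R, RCLike.re (inner 𝕜 x (balakrishnanIntegral A α x R)) =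
      ∫ t in Set.Ioc 0 R, φ t := fun R => by
    rw [inner_balakrishnanIntegral hA hpos hα]
    exact (integral_re ((integrableOn_balakrishnanIntegrand_Ioc hA hpos hα x R).const_inner x)).symm
  have hlim : Tendsto (fun R => Real.sin (Real.pi * α) / Real.pi * ∫ t in Set.Ioc 0 R, φ t)
      atTop (𝓝 0) := by
    have h1 := (RCLike.continuous_re.tendsto _).comp
      ((tendsto_const_nhds (x := x)).inner (𝕜 := 𝕜) (tendsto_fracPow hx))
    rw [h, inner_zero_right, map_zero] at h1
    refine h1.congr fun R => ?_
    rw [Function.comp_apply, inner_smul_right, RCLike.re_ofReal_mul, hre]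
  have hmono : Monotone fun R => Real.sin (Real.pi * α) / Real.pi * ∫ t in Set.Ioc 0 R, φ t := by
    intro R S hRS
    refine mul_le_mul_of_nonneg_left ?_ hsin.le
    refine setIntegral_mono_set (hint S) ?_ (Set.Ioc_subset_Ioc_right hRS).eventuallyLE
    filter_upwards [ae_restrict_mem measurableSet_Ioc] with t ht
    exact hφnn t ht.1
  have h0 : ∫ t in Set.Ioc (0 : ℝ) 1, φ t = 0 := by
    refine le_antisymm ?_ (setIntegral_nonneg measurableSet_Ioc fun t ht => hφnn t ht.1)
    exact nonpos_of_mul_nonpos_right (hmono.ge_of_tendsto hlim 1) hsin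
  rw [setIntegral_eq_zero_iff_of_nonneg_ae ?_ (hint 1)] at h0
  · have hne : (volume.restrict (Set.Ioc (0 : ℝ) 1)) ≠ 0 := by
      rw [Ne, Measure.restrict_eq_zero, Real.volume_Ioc]
      simp
    have : (ae (volume.restrict (Set.Ioc (0 : ℝ) 1))).NeBot := ae_neBot.2 hne
    -- One such `t` suffices: `A (t + A)⁻¹ x = 0` already implies `A x = 0`.
    obtain ⟨t, ht, ht'⟩ := (h0.and (ae_restrict_mem measurableSet_Ioc)).exists
    refine val_eq_zero_of_resolventPart_eq_zero hA hpos ht'.1 ?_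
    have h2 := hφ0 t ht'.1
    rw [ht, Pi.zero_apply] at h2
    have h3 := nonpos_of_mul_nonpos_right h2 (Real.rpow_pos_of_pos ht'.1 _)
    exact norm_eq_zero.1 (pow_eq_zero_iff two_ne_zero |>.1 (le_antisymm h3 (sq_nonneg _)))
  · filter_upwards [ae_restrict_mem measurableSet_Ioc] with t ht
    exact hφnn t ht.1

/-! ### Real powers on smooth vectors -/

omit [CompleteSpace H] in
theorem smoothVectors_le_of_comm {B : H →ₗ.[𝕜] H}
    (hB : ∀ x ∈ smoothVectors A, val B x ∈ A.domain ∧ val A (val B x) = val B (val A x)) :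
    ∀ x ∈ smoothVectors A, val B x ∈ smoothVectors A := by
  have key : ∀ n, ∀ x ∈ smoothVectors A, val B x ∈ (npow A n).domain := by
    intro n
    induction n with
    | zero => exact fun x _ => mem_npow_zero A _
    | succ n ih =>
      intro x hx
      rw [mem_npow_succ_left, (hB x hx).2]
      exact ⟨(hB x hx).1, ih _ (val_mem_smoothVectors hx)⟩
  exact fun x hx => mem_smoothVectors.2 fun n => key n x hx

omit [CompleteSpace H] in
theorem val_npow_mem_smoothVectors (n : ℕ) {x : H} (hx : x ∈ smoothVectors A) :
    val (npow A n) x ∈ smoothVectors A := by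
  rw [val_npow_coe A n ⟨x, hx⟩]
  exact Subtype.prop _

omit [CompleteSpace H] in
theorem val_npow_comm (n : ℕ) {x : H} (hx : x ∈ smoothVectors A) :
    val A (val (npow A n) x) = val (npow A n) (val A x) := by
  rw [← val_npow_succ (mem_smoothVectors.1 hx _), val_npow_succ_left (mem_smoothVectors.1 hx _)]

/-- Powers come off one at a time: if `A (A y) = 0` then `‖A y‖ ^ 2 = ⟨y, A (A y)⟩ = 0`. -/
theorem val_eq_zero_of_npow_succ_eq_zero (hA : IsSelfAdjoint A) (n : ℕ) {x : H}
    (hx : x ∈ smoothVectors A) (h : val (npow A (n + 1)) x = 0) : val A x = 0 := by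
  induction n with
  | zero => rwa [val_npow_succ (mem_smoothVectors.1 hx _), val_npow_zero] at h
  | succ n ih =>
    refine ih ?_
    rw [val_npow_succ (mem_smoothVectors.1 hx _)] at h ⊢
    have hy := val_npow_mem_smoothVectors n hx
    have hy' := val_mem_smoothVectors hy
    rw [val_npow_succ (mem_smoothVectors.1 hx _)] at h
    rw [← inner_self_eq_zero (𝕜 := 𝕜), inner_val_left hA (smoothVectors_le_domain A hy)
      (smoothVectors_le_domain A hy'), h, inner_zero_right]

variable {s : ℝ}

theorem smoothVectors_le_rpow_domain (hA : IsSelfAdjoint A) (hpos : IsNonneg A) :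
    smoothVectors A ≤ (rpow A s).domain := fun x hx => by
  rw [rpow]
  split_ifs with h
  · exact mem_smoothVectors.1 hx _
  · exact mem_comp_domain.2 ⟨mem_smoothVectors.1 hx _,
      domain_le_fracPow_domain hA hpos (Int.fract_pos.2 fun h' => h (by rw [h', Int.fract_intCast]))
        (Int.fract_lt_one s) (smoothVectors_le_domain A (val_npow_mem_smoothVectors _ hx))⟩

theorem val_rpow_comm (hA : IsSelfAdjoint A) (hpos : IsNonneg A) {x : H}
    (hx : x ∈ smoothVectors A) :
    val (rpow A s) x ∈ A.domain ∧ val A (val (rpow A s) x) = val (rpow A s) (val A x) := by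
  rw [rpow]
  split_ifs with h
  · exact ⟨smoothVectors_le_domain A (val_npow_mem_smoothVectors _ hx), val_npow_comm _ hx⟩
  · have h0 : 0 < Int.fract s := lt_of_le_of_ne (Int.fract_nonneg s) (Ne.symm h)
    have hle := domain_le_fracPow_domain hA hpos h0 (Int.fract_lt_one s)
    have hy := val_npow_mem_smoothVectors ⌊s⌋₊ hx
    have hy' := val_npow_mem_smoothVectors ⌊s⌋₊ (val_mem_smoothVectors hx)
    rw [val_comp (mem_smoothVectors.1 hx _) (hle (smoothVectors_le_domain A hy)),
      val_comp (mem_smoothVectors.1 (val_mem_smoothVectors hx) _)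
        (hle (smoothVectors_le_domain A hy')), ← val_npow_comm _ hx]
    exact fracPow_comm hA hpos h0 (Int.fract_lt_one s) (smoothVectors_le_domain A hy)
      (smoothVectors_le_domain A (val_mem_smoothVectors hy))

/-- The first alternative accounts for `A ^ 0`, the identity, whose kernel is trivial. In the
fractional case `A ^ α A ^ n x = 0` gives `A ^ (n + 1) x = 0`. -/
theorem eq_zero_or_val_eq_zero_of_rpow_eq_zero (hA : IsSelfAdjoint A) (hpos : IsNonneg A) {x : H}
    (hx : x ∈ smoothVectors A) (h0 : val (rpow A s) x = 0) : x = 0 ∨ val A x = 0 := by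
  have hn : ∀ n : ℕ, val (npow A n) x = 0 → x = 0 ∨ val A x = 0 := by
    rintro (_ | n) h
    · exact Or.inl (by rwa [val_npow_zero] at h)
    · exact Or.inr (val_eq_zero_of_npow_succ_eq_zero hA n hx h)
  rw [rpow] at h0
  split_ifs at h0 with h
  · exact hn _ h0
  · have hf : 0 < Int.fract s := lt_of_le_of_ne (Int.fract_nonneg s) (Ne.symm h)
    have hle := domain_le_fracPow_domain hA hpos hf (Int.fract_lt_one s)
    have hy := hle (smoothVectors_le_domain A (val_npow_mem_smoothVectors ⌊s⌋₊ hx))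
    rw [val_comp (mem_smoothVectors.1 hx _) hy] at h0
    have := val_eq_zero_of_fracPow_eq_zero hA hpos hf (Int.fract_lt_one s) hy h0
    rw [← val_npow_succ (mem_smoothVectors.1 hx _)] at this
    exact Or.inr (val_eq_zero_of_npow_succ_eq_zero hA _ hx this)

end FractionalPowers

section Krylov

variable {𝕜 : Type*} [RCLike 𝕜]

/-! ### Minimisation over a Krylov space -/

section Minimisation

variable {V : Type*} [NormedAddCommGroup V] [InnerProductSpace 𝕜 V]

/-- `B k` is the orthogonal projection of `-B e` onto the finite-dimensional space `B(K)`, which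
exists although `V` need not be complete. Pythagoras gives minimality, and injectivity on `K` gives
uniqueness. -/
theorem exists_minimizer (B : V →ₗ[𝕜] V) (K : Submodule 𝕜 V) [FiniteDimensional 𝕜 K]
    (hinj : ∀ k ∈ K, B k = 0 → k = 0) (e : V) :
    ∃ k ∈ K, (∀ k' ∈ K, ‖B (e + k)‖ ≤ ‖B (e + k')‖) ∧
      ∀ k' ∈ K, ‖B (e + k')‖ ≤ ‖B (e + k)‖ → k' = k := by
  obtain ⟨k, hk, hkw⟩ := ((K.map B).orthogonalProjectionOnto (-B e)).2
  have horth : B (e + k) ∈ (K.map B)ᗮ := by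
    have h := (K.map B).sub_starProjection_mem_orthogonal (-B e)
    rw [← Submodule.neg_mem_iff, map_add]
    convert h using 1
    rw [Submodule.starProjection_apply, ← hkw]
    abel
  have hpyth : ∀ k' ∈ K, ‖B (e + k')‖ ^ 2 = ‖B (e + k)‖ ^ 2 + ‖B (k' - k)‖ ^ 2 := by
    intro k' hk'
    have h0 : inner 𝕜 (B (e + k)) (B (k' - k)) = 0 :=
      Submodule.inner_left_of_mem_orthogonal
        (Submodule.mem_map_of_mem (K.sub_mem hk' hk)) horth
    have h1 : B (e + k') = B (e + k) + B (k' - k) := by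
      rw [← map_add]; congr 1; abel
    rw [h1, @norm_add_sq 𝕜, h0, map_zero]
    ring
  refine ⟨k, hk, fun k' hk' => ?_, fun k' hk' hle => ?_⟩
  · refine le_of_abs_le (abs_le_of_sq_le_sq ?_ (norm_nonneg _))
    rw [hpyth k' hk']
    exact le_add_of_nonneg_right (sq_nonneg _)
  · have h1 := hpyth k' hk'
    have h2 := pow_le_pow_left₀ (norm_nonneg _) hle 2
    have h3 : ‖B (k' - k)‖ ^ 2 = 0 := le_antisymm (by linarith) (sq_nonneg _)
    exact sub_eq_zero.1 (hinj _ (K.sub_mem hk' hk) (norm_eq_zero.1 (by simpa using h3)))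

/-! ### Reality of the minimising coefficients -/

theorem inner_pow_swap {T : V →ₗ[𝕜] V} (hT : T.IsSymmetric) (w : V) (i j : ℕ) :
    inner 𝕜 ((T ^ i) w) ((T ^ j) w) = inner 𝕜 ((T ^ j) w) ((T ^ i) w) := by
  rw [hT.pow i, hT.pow j, ← Module.End.mul_apply, ← Module.End.mul_apply, ← pow_add, ← pow_add,
    add_comm]

theorem im_inner_sum_pow {T : V →ₗ[𝕜] V} (hT : T.IsSymmetric) (w : V) (s t : Finset ℕ)
    (a b : ℕ → ℝ) :
    RCLike.im (inner 𝕜 (∑ i ∈ s, (a i : 𝕜) • (T ^ i) w) (∑ j ∈ t, (b j : 𝕜) • (T ^ j) w)) = 0 := by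
  have h : ∀ i j, RCLike.im (inner 𝕜 ((T ^ i) w) ((T ^ j) w)) = 0 := fun i j => by
    rw [← RCLike.conj_eq_iff_im, inner_conj_symm, inner_pow_swap hT]
  simp only [sum_inner, inner_sum, inner_smul_left, inner_smul_right, map_sum,
    RCLike.conj_ofReal, RCLike.im_ofReal_mul, h, mul_zero, Finset.sum_const_zero]

/-- Replacing the coefficients by their real parts does not increase the norm. -/
theorem norm_sum_re_le {T : V →ₗ[𝕜] V} (hT : T.IsSymmetric) (w : V) (N : ℕ) (c : ℕ → 𝕜) :
    ‖w + ∑ j ∈ Finset.range N, ((RCLike.re (c j) : ℝ) : 𝕜) • (T ^ (j + 1)) w‖ ≤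
      ‖w + ∑ j ∈ Finset.range N, c j • (T ^ (j + 1)) w‖ := by
  have h1 : ∀ a : ℕ → ℝ, w + ∑ j ∈ Finset.range N, (a j : 𝕜) • (T ^ (j + 1)) w =
      ∑ j ∈ Finset.range (N + 1), ((if j = 0 then 1 else a (j - 1) : ℝ) : 𝕜) • (T ^ j) w := fun a => by
    rw [Finset.sum_range_succ']
    simp [add_comm]
  have h2 : ∀ b : ℕ → ℝ, ∑ j ∈ Finset.range N, (b j : 𝕜) • (T ^ (j + 1)) w =
      ∑ j ∈ Finset.range (N + 1), ((if j = 0 then 0 else b (j - 1) : ℝ) : 𝕜) • (T ^ j) w := fun b => by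
    rw [Finset.sum_range_succ']
    simp
  have h3 : w + ∑ j ∈ Finset.range N, c j • (T ^ (j + 1)) w =
      (w + ∑ j ∈ Finset.range N, ((RCLike.re (c j) : ℝ) : 𝕜) • (T ^ (j + 1)) w) +
        (RCLike.I : 𝕜) • ∑ j ∈ Finset.range N, ((RCLike.im (c j) : ℝ) : 𝕜) • (T ^ (j + 1)) w := by
    rw [add_assoc, Finset.smul_sum, ← Finset.sum_add_distrib]
    congr 1
    refine Finset.sum_congr rfl fun j _ => ?_
    rw [smul_smul, ← add_smul, mul_comm, RCLike.re_add_im]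
  rw [h3]
  refine le_of_abs_le (abs_le_of_sq_le_sq ?_ (norm_nonneg _))
  -- For real combinations `u`, `v` of the `T ^ j w` the cross term is `Re ⟨u, i v⟩ = -Im ⟨u, v⟩ =
  -- 0`. Over the reals `RCLike.I` is `0`.
  rw [@norm_add_sq 𝕜 _ _ _ _ (w + _), inner_smul_right, RCLike.I_mul_re,
    h1 fun j => RCLike.re (c j), h2 fun j => RCLike.im (c j), im_inner_sum_pow hT]
  nlinarith [sq_nonneg ‖(RCLike.I : 𝕜) • ∑ j ∈ Finset.range (N + 1),
    ((if j = 0 then 0 else RCLike.im (c (j - 1)) : ℝ) : 𝕜) • (T ^ j) w‖]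

/-- The space spanned by `T e, …, T ^ N e`. -/
def krylovSpan (T : V →ₗ[𝕜] V) (e : V) (N : ℕ) : Submodule 𝕜 V :=
  Submodule.span 𝕜 ((fun j => (T ^ (j + 1)) e) '' (Finset.range N : Set ℕ))

instance (T : V →ₗ[𝕜] V) (e : V) (N : ℕ) : FiniteDimensional 𝕜 (krylovSpan T e N) :=
  FiniteDimensional.span_of_finite 𝕜 ((Finset.finite_toSet _).image _)

theorem mem_krylovSpan_iff {T : V →ₗ[𝕜] V} {e : V} {N : ℕ} {k : V} :
    k ∈ krylovSpan T e N ↔ ∃ c : ℕ → 𝕜, ∑ j ∈ Finset.range N, c j • (T ^ (j + 1)) e = k := by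
  classical
  rw [krylovSpan, Submodule.mem_span_image_finset_iff_exists_fun]
  constructor
  · rintro ⟨c, rfl⟩
    refine ⟨fun j => if h : j ∈ Finset.range N then c ⟨j, h⟩ else 0, ?_⟩
    rw [← Finset.sum_coe_sort]
    exact Finset.sum_congr rfl fun j _ => by simp only [dif_pos j.2]
  · rintro ⟨c, rfl⟩
    exact ⟨fun j => c j, Finset.sum_coe_sort _ fun j => c j • (T ^ (j + 1)) e⟩

/-- As `B` commutes with `T`, `B (e + k)` has the coefficients of `e + k` with `B e` in place of
`e`. Taking real parts yields a competitor that is no worse, hence `k` itself. -/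
theorem exists_real_coeff_of_minimizer {T B : V →ₗ[𝕜] V} (hT : T.IsSymmetric)
    (hTB : Commute T B) {e k : V} {N : ℕ} (hk : k ∈ krylovSpan T e N)
    (huniq : ∀ k' ∈ krylovSpan T e N, ‖B (e + k')‖ ≤ ‖B (e + k)‖ → k' = k) :
    ∃ a : ℕ → ℝ, k = ∑ j ∈ Finset.range N, (a j : 𝕜) • (T ^ (j + 1)) e := by
  obtain ⟨c, rfl⟩ := mem_krylovSpan_iff.1 hk
  have hB : ∀ c : ℕ → 𝕜, B (e + ∑ j ∈ Finset.range N, c j • (T ^ (j + 1)) e) =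
      B e + ∑ j ∈ Finset.range N, c j • (T ^ (j + 1)) (B e) := fun c => by
    simp only [map_add, map_sum, map_smul]
    congr 1
    refine Finset.sum_congr rfl fun j _ => ?_
    rw [← Module.End.mul_apply, ← Module.End.mul_apply, ((hTB.pow_left (j + 1)).eq)]
  refine ⟨fun j => RCLike.re (c j), (huniq _ (mem_krylovSpan_iff.2 ⟨_, rfl⟩) ?_).symm⟩
  rw [hB, hB]
  exact norm_sum_re_le hT (B e) N c

end Minimisation

end Krylov

section SolutionManifold

variable {𝕜 : Type*} [RCLike 𝕜] {H : Type*} [NormedAddCommGroup H] [InnerProductSpace 𝕜 H]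
variable [CompleteSpace H] {A : H →ₗ.[𝕜] H}

/-! ### The solution manifold -/

theorem val_mem_ker_orthogonal (hA : IsSelfAdjoint A) {x : H} (hx : x ∈ A.domain) :
    val A x ∈ (ker A)ᗮ := by
  rw [Submodule.mem_orthogonal']
  intro u hu
  rw [mem_ker_iff] at hu
  rw [inner_val_left hA hx hu.1, hu.2, inner_zero_right]

theorem ker_eq_ran_orthogonal (hA : IsSelfAdjoint A) : ker A = (ran A)ᗮ := by
  ext x
  rw [mem_ker_iff, Submodule.mem_orthogonal]
  constructor
  · rintro ⟨hx, hx0⟩ _ ⟨y, rfl⟩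
    change inner 𝕜 (A y) x = 0
    rw [← val_of_mem A y.2, inner_val_left hA y.2 hx, hx0, inner_zero_right]
  · intro h
    refine mem_domain_of_inner hA fun u hu => ?_
    rw [inner_zero_left, ← inner_conj_symm, h (val A u) ⟨⟨u, hu⟩, (val_of_mem A hu).symm⟩, map_zero]

theorem exists_mem_solutionSet_sub_mem (hA : IsSelfAdjoint A) {g : H} (hg : g ∈ ran A) (x : H) :
    ∃ p ∈ solutionSet A g, x - p ∈ (ker A)ᗮ := by
  have hcl : IsClosed (ker A : Set H) := by
    rw [ker_eq_ran_orthogonal hA]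
    exact Submodule.isClosed_orthogonal _
  have : CompleteSpace (ker A) := hcl.completeSpace_coe
  obtain ⟨y, rfl⟩ := hg
  obtain ⟨hk1, hk2⟩ := mem_ker_iff.1 ((ker A).starProjection_apply_mem (x - y))
  -- The solutions form `y + ker A`, so the nearest one to `x` is reached by projecting `x - y` onto
  -- `ker A`.
  refine ⟨y + (ker A).starProjection (x - y), mem_solutionSet_iff.2
    ⟨A.domain.add_mem y.2 hk1, ?_⟩, ?_⟩
  · rw [val_add A y.2 hk1, hk2, add_zero, val_of_mem A y.2]
    rfl
  · rw [← sub_sub]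
    exact (ker A).sub_starProjection_mem_orthogonal (x - y)

omit [CompleteSpace H] in
-- Solutions differ by elements of `ker A`, so by Pythagoras `p` is the only closest one, and the
-- choice made in `proj` must return it.
theorem proj_eq_of_sub_mem {g x p : H} (hp : p ∈ solutionSet A g) (hxp : x - p ∈ (ker A)ᗮ) :
    proj (solutionSet A g) x = p := by
  have hpyth : ∀ z ∈ solutionSet A g, ‖x - z‖ ^ 2 = ‖x - p‖ ^ 2 + ‖p - z‖ ^ 2 := fun z hz => by
    rw [mem_solutionSet_iff] at hz hp
    have hk : p - z ∈ ker A := mem_ker_iff.2 ⟨A.domain.sub_mem hp.1 hz.1, by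
      rw [val_sub A hp.1 hz.1, hp.2, hz.2, sub_self]⟩
    rw [← sub_add_sub_cancel x p z, @norm_add_sq 𝕜,
      Submodule.inner_left_of_mem_orthogonal hk hxp, map_zero]
    ring
  have hspec := Classical.epsilon_spec
    (p := fun y => y ∈ solutionSet A g ∧ ∀ z ∈ solutionSet A g, ‖x - y‖ ≤ ‖x - z‖)
    ⟨p, hp, fun z hz => le_of_abs_le (abs_le_of_sq_le_sq
      (by rw [hpyth z hz]; exact le_add_of_nonneg_right (sq_nonneg _)) (norm_nonneg _))⟩
  change proj (solutionSet A g) x ∈ _ ∧ _ at hspec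
  have h1 := pow_le_pow_left₀ (norm_nonneg _) (hspec.2 p hp) 2
  change ‖x - proj (solutionSet A g) x‖ ^ 2 ≤ _ at h1
  rw [hpyth _ hspec.1] at h1
  have h2 : ‖p - proj (solutionSet A g) x‖ ^ 2 = 0 := le_antisymm (by linarith) (sq_nonneg _)
  exact (sub_eq_zero.1 (norm_eq_zero.1 (by simpa using h2))).symm

/-! ### The Krylov space on smooth vectors -/

theorem isSymmetric_smoothMap (hA : IsSelfAdjoint A) : (smoothMap A).IsSymmetric := fun x y =>
  inner_val_left hA (smoothVectors_le_domain A x.2) (smoothVectors_le_domain A y.2)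

omit [CompleteSpace H] in
theorem krylov_val_eq_map (e : smoothVectors A) (N : ℕ) :
    krylov A (val A e) N = (krylovSpan (smoothMap A) e N).map (smoothVectors A).subtype := by
  rw [krylov, krylovSpan, Submodule.map_span, Set.image_image]
  congr 1
  ext v
  simp only [Set.mem_ofPred_eq, Set.mem_image, Finset.coe_range, Set.mem_Iio]
  refine exists_congr fun j => and_congr_right fun _ => ?_
  rw [← coe_smoothMap, val_npow_coe, pow_succ, eq_comm]
  rfl

theorem coe_krylovSpan_mem_ker_orthogonal (hA : IsSelfAdjoint A) {e k : smoothVectors A} {N : ℕ}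
    (hk : k ∈ krylovSpan (smoothMap A) e N) : (k : H) ∈ (ker A)ᗮ := by
  have h : krylovSpan (smoothMap A) e N ≤ (ker A)ᗮ.comap (smoothVectors A).subtype := by
    refine Submodule.span_le.2 ?_
    rintro _ ⟨j, -, rfl⟩
    simp only [pow_succ']
    exact val_mem_ker_orthogonal hA (smoothVectors_le_domain A (Subtype.prop _))
  exact h hk

/-- The power `A ^ s` on the smooth vectors of `A`. -/
def smoothRpow (hA : IsSelfAdjoint A) (hpos : IsNonneg A) (s : ℝ) :
    smoothVectors A →ₗ[𝕜] smoothVectors A :=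
  restrict (rpow A s) (smoothVectors A) (smoothVectors_le_rpow_domain hA hpos)
    (smoothVectors_le_of_comm fun _ hx => val_rpow_comm hA hpos hx)

theorem commute_smoothMap_smoothRpow (hA : IsSelfAdjoint A) (hpos : IsNonneg A) (s : ℝ) :
    Commute (smoothMap A) (smoothRpow hA hpos s) :=
  LinearMap.ext fun x => Subtype.ext (val_rpow_comm hA hpos x.2).2

/-- The kernel of the power lies in `ker A`, while the Krylov space is orthogonal to `ker A`. -/
theorem smoothRpow_injOn (hA : IsSelfAdjoint A) (hpos : IsNonneg A) (s : ℝ)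
    {e k : smoothVectors A} {N : ℕ} (hk : k ∈ krylovSpan (smoothMap A) e N)
    (h : smoothRpow hA hpos s k = 0) : k = 0 := by
  have h' : val (rpow A s) k = 0 := congrArg Subtype.val h
  rcases eq_zero_or_val_eq_zero_of_rpow_eq_zero hA hpos k.2 h' with h0 | h0
  · exact Subtype.ext h0
  · have h1 : (k : H) ∈ ker A := mem_ker_iff.2 ⟨smoothVectors_le_domain A k.2, h0⟩
    exact Subtype.ext (inner_self_eq_zero (𝕜 := 𝕜) |>.1
      (Submodule.inner_right_of_mem_orthogonal h1 (coe_krylovSpan_mem_ker_orthogonal hA hk)))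

omit [CompleteSpace H] in
theorem exists_polyOp_eq (e : smoothVectors A) (N : ℕ) (a : ℕ → ℝ) :
    ∃ p : Polynomial ℝ, p.natDegree ≤ N ∧ p.eval 0 = 1 ∧
      ∃ h : (e : H) ∈ (polyOp p A).domain,
        ((e + ∑ j ∈ Finset.range N, (a j : 𝕜) • (smoothMap A ^ (j + 1)) e : smoothVectors A) : H) =
          polyOp p A ⟨e, h⟩ := by
  -- The coefficient `1` of `e` becomes `p(0) = 1`, and `a j` belongs to degree `j + 1`.
  set b : ℕ → ℝ := fun j => if j = 0 then 1 else a (j - 1) with hb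
  set p : Polynomial ℝ := ∑ j ∈ Finset.range (N + 1), Polynomial.monomial j (b j) with hp
  have hcoeff : ∀ j ∈ Finset.range (N + 1), p.coeff j = b j := fun j hj => by
    simp only [hp, Polynomial.finsetSum_coeff, Polynomial.coeff_monomial]
    rw [Finset.sum_ite_eq', if_pos hj]
  have hdeg : p.natDegree ≤ N := Polynomial.natDegree_sum_le_of_forall_le _ _ fun j hj =>
    (Polynomial.natDegree_monomial_le _).trans (Nat.lt_succ_iff.1 (Finset.mem_range.1 hj))
  obtain ⟨h1, h2⟩ := polyOp_smooth p A e
  refine ⟨p, hdeg, ?_, h1, ?_⟩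
  · rw [← Polynomial.coeff_zero_eq_eval_zero, hcoeff 0 (by simp), hb]
    simp
  · have hsum : (p.sum fun k a => (a : 𝕜) • (smoothMap A ^ k) e) =
        ∑ j ∈ Finset.range (N + 1), (b j : 𝕜) • (smoothMap A ^ j) e := by
      rw [Polynomial.sum_over_range' p (by simp) (N + 1) (Nat.lt_succ_of_le hdeg)]
      exact Finset.sum_congr rfl fun j hj => by rw [hcoeff j hj]
    rw [h2, hsum, Finset.sum_range_succ']
    simp [hb, add_comm]

end SolutionManifold

end UnboundedOp

end

/-! ### Existence, uniqueness and structure of the iterates -/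

theorem proposition2p1 {𝕜 : Type*} [RCLike 𝕜] {H : Type*} [NormedAddCommGroup H]
    [InnerProductSpace 𝕜 H] [CompleteSpace H] (A : H →ₗ.[𝕜] H) (hA : IsSelfAdjoint A)
    (hpos : UnboundedOp.IsNonneg A) (g f₀ : H) (hg : g ∈ UnboundedOp.ran A)
    (hg_smooth : g ∈ UnboundedOp.smoothVectors A) (hf₀ : f₀ ∈ UnboundedOp.smoothVectors A)
    (θ : ℝ) (hθ : 0 ≤ θ) :
    (∃! f : ℕ → H, UnboundedOp.IsThetaIterates A g f₀ θ f) ∧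
    ∀ f : ℕ → H, UnboundedOp.IsThetaIterates A g f₀ θ f →
      (∀ N : ℕ, f N - UnboundedOp.proj (UnboundedOp.solutionSet A g) (f N) ∈
        (UnboundedOp.ker A)ᗮ) ∧
      (∀ N : ℕ, 1 ≤ N → UnboundedOp.proj (UnboundedOp.solutionSet A g) (f N) =
        UnboundedOp.proj (UnboundedOp.solutionSet A g) (f 0)) ∧
      (∀ N : ℕ, 1 ≤ N → ∃ p : Polynomial ℝ, p.natDegree ≤ N ∧ p.eval 0 = 1 ∧
        ∃ h : f 0 - UnboundedOp.proj (UnboundedOp.solutionSet A g) (f 0) ∈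
            (UnboundedOp.polyOp p A).domain,
          f N - UnboundedOp.proj (UnboundedOp.solutionSet A g) (f N) =
            UnboundedOp.polyOp p A ⟨_, h⟩) := by
  open UnboundedOp in
  obtain ⟨q, hq, hfq⟩ := exists_mem_solutionSet_sub_mem hA hg f₀
  have hq' := mem_solutionSet_iff.1 hq
  have hqs : q ∈ smoothVectors A := mem_smoothVectors_iff.2 ⟨hq'.1, by rwa [hq'.2]⟩
  obtain ⟨e, he⟩ : ∃ e : smoothVectors A, (e : H) = f₀ - q :=
    ⟨⟨f₀ - q, Submodule.sub_mem _ hf₀ hqs⟩, rfl⟩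
  rw [← he] at hfq
  have hf₀e : f₀ = q + e := by rw [he]; abel
  have hres : val A f₀ - g = val A e := by
    rw [he, val_sub A (smoothVectors_le_domain A hf₀) hq'.1, hq'.2]
  set T := smoothMap A
  set B := smoothRpow hA hpos (θ / 2) with hB
  have hsearch : ∀ N h, h ∈ searchSpace A g f₀ N ↔ ∃ k ∈ krylovSpan T e N, f₀ + k = h := by
    intro N h
    change h - f₀ ∈ krylov A _ N ↔ _
    rw [hres, krylov_val_eq_map, Submodule.mem_map]
    exact exists_congr fun k => and_congr_right fun _ => eq_sub_iff_add_eq'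
  -- The same `q` serves every `N` and `k`, which makes the nonlinear-looking functional an affine
  -- least-squares problem.
  have hproj : ∀ N, ∀ k ∈ krylovSpan T e N, proj (solutionSet A g) (f₀ + k) = q ∧
      f₀ + k - q = ((e + k : smoothVectors A) : H) ∧ f₀ + k - q ∈ (ker A)ᗮ := by
    intro N k hk
    have h1 : f₀ + k - q = ((e + k : smoothVectors A) : H) := by
      rw [hf₀e, Submodule.coe_add]; abel
    have h2 : f₀ + k - q ∈ (ker A)ᗮ := by
      rw [h1, Submodule.coe_add]
      exact Submodule.add_mem _ hfq (coe_krylovSpan_mem_ker_orthogonal hA hk)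
    exact ⟨proj_eq_of_sub_mem hq h2, h1, h2⟩
  have herr : ∀ N, ∀ k ∈ krylovSpan T e N,
      err A g (f₀ + k) = ((e + k : smoothVectors A) : H) := fun N k hk => by
    rw [err, (hproj N k hk).1, (hproj N k hk).2.1]
  have hnorm : ∀ N, ∀ k ∈ krylovSpan T e N,
      ‖val (rpow A (θ / 2)) (err A g (f₀ + k))‖ = ‖B (e + k)‖ := fun N k hk => by
    rw [herr N k hk]; rfl
  choose k hk hmin huniq using fun N =>
    exists_minimizer B (krylovSpan T e N) (fun _ => smoothRpow_injOn hA hpos _) e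
  have hzero : proj (solutionSet A g) f₀ = q := proj_eq_of_sub_mem hq (he ▸ hfq)
  have hiter : ∀ f, IsThetaIterates A g f₀ θ f → ∀ N, 1 ≤ N → f N = f₀ + k N := by
    intro f hf N hN
    obtain ⟨-, h1, h2⟩ := hf.2 N hN
    obtain ⟨k', hk', hfk⟩ := (hsearch N _).1 h1
    have h3 := h2 _ ((hsearch N _).2 ⟨k N, hk N, rfl⟩)
    rw [← hfk, hnorm N _ hk', hnorm N _ (hk N)] at h3
    rw [← hfk, huniq N k' hk' h3]
  refine ⟨⟨fun N => if N = 0 then f₀ else f₀ + k N, ⟨if_pos rfl, fun N hN => ?_⟩,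
    fun f hf => ?_⟩, fun f hf => ⟨fun N => ?_, fun N hN => ?_, fun N hN => ?_⟩⟩
  · have hN' : N ≠ 0 := Nat.one_le_iff_ne_zero.1 hN
    simp only [if_neg hN']
    refine ⟨fun h hh => ?_, (hsearch N _).2 ⟨_, hk N, rfl⟩, fun h hh => ?_⟩
    · obtain ⟨k', hk', rfl⟩ := (hsearch N _).1 hh
      rw [herr N k' hk']
      exact smoothVectors_le_rpow_domain hA hpos (Subtype.prop _)
    · obtain ⟨k', hk', rfl⟩ := (hsearch N _).1 hh
      rw [hnorm N _ (hk N), hnorm N _ hk']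
      exact hmin N k' hk'
  · funext N
    rcases Nat.eq_zero_or_pos N with rfl | hN
    · exact hf.1
    · rw [hiter f hf N hN, if_neg hN.ne']
  · rcases Nat.eq_zero_or_pos N with rfl | hN
    · rw [hf.1, hzero, ← he]
      exact hfq
    · rw [hiter f hf N hN, (hproj N _ (hk N)).1]
      exact (hproj N _ (hk N)).2.2
  · rw [hiter f hf N hN, hf.1, (hproj N _ (hk N)).1, hzero]
  · obtain ⟨a, ha⟩ := exists_real_coeff_of_minimizer (isSymmetric_smoothMap hA)
      (commute_smoothMap_smoothRpow hA hpos (θ / 2)) (hk N) (huniq N)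
    obtain ⟨p, hp1, hp2, hp3⟩ := exists_polyOp_eq e N a
    refine ⟨p, hp1, hp2, ?_⟩
    rw [hf.1, hzero, hiter f hf N hN, (hproj N _ (hk N)).1, (hproj N _ (hk N)).2.1, ha, ← he]
    exact hp3
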